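/- For a group $G$, a subset is called elementary algebraic if it has the form $\{x\in G : x^{\varepsilon_1}a_1x^{\varepsilon_2}a_2\cdots x^{\varepsilon_n}a_n=1\}$ for some integer $n>0$, elements $a_1,\dots,a_n\in G$ and exponents $\varepsilon_1,\dots,\varepsilon_n\in\{-1,1\}$. The Zariski topology $\mathfrak{Z}_G$ is the topology on $G$ whose closed sets are exactly the intersections of finite (possibly empty) unions of elementary algebraic sets. A topological group is precompact if it is isomorphic, as a topological group, to a subgroup of a compact Hausdorff group; a precompact metric group topology on $G$ is a metrizable group topology that makes $G$ a precompact group. Theorem D. Let $X$ be a subset of an abelian group $G$ such that $|G|\le\mathfrak{c}$, where $\mathfrak{c}$ is the cardinality of the continuum. Then the following conditions are equivalent: (i) $X$ is potentially dense in $G$, that is, $X$ is dense in $(G,\mathcal{T})$ for some Hausdorff group topology $\mathcal{T}$ on $G$; (ii) $X$ is dense in $(G,\mathcal{T})$ for some precompact metric group topology $\mathcal{T}$ on $G$; (iii) $X$ is Zariski dense in $G$, that is, the closure of $X$ in $(G,\mathfrak{Z}_G)$ is equal to $G$. -/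

import Mathlib

/-!
Markov's algebraic and potentially dense subsets of a group, the Zariski topology of a group, and
precompact metric group topologies. Groups are written additively; commutativity is not assumed in
the definitions, so the order of summation matters (`List.sum`).
-/

namespace MarkovZariski

universe u

/-- An elementary algebraic subset of `G`: the solution set of one equation
`ε₁x + a₁ + ε₂x + a₂ + ⋯ + εₙx + aₙ = 0` with `n > 0`, `aᵢ ∈ G` and `εᵢ ∈ {-1, 1}`. -/
def IsElementaryAlgebraic {G : Type u} [AddGroup G] (E : Set G) : Prop :=
  ∃ (n : ℕ) (a : Fin n → G) (ε : Fin n → ℤ), 0 < n ∧ (∀ i, ε i = -1 ∨ ε i = 1) ∧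
    E = {x : G | (List.ofFn fun i => ε i • x + a i).sum = 0}

/-- A finite union of elementary algebraic subsets of `G` (the empty union is allowed). -/
def IsFiniteUnionElementary {G : Type u} [AddGroup G] (F : Set G) : Prop :=
  ∃ S : Set (Set G), S.Finite ∧ (∀ E ∈ S, IsElementaryAlgebraic E) ∧ F = ⋃₀ S

/-- An algebraic subset of `G`: an intersection of finite unions of elementary algebraic sets. -/
def IsAlgebraicSubset {G : Type u} [AddGroup G] (A : Set G) : Prop :=
  ∃ C : Set (Set G), (∀ F ∈ C, IsFiniteUnionElementary F) ∧ A = ⋂₀ C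

theorem IsFiniteUnionElementary.union {G : Type u} [AddGroup G] {F₁ F₂ : Set G}
    (h₁ : IsFiniteUnionElementary F₁) (h₂ : IsFiniteUnionElementary F₂) :
    IsFiniteUnionElementary (F₁ ∪ F₂) := by
  obtain ⟨S₁, f₁, e₁, rfl⟩ := h₁
  obtain ⟨S₂, f₂, e₂, rfl⟩ := h₂
  refine ⟨S₁ ∪ S₂, f₁.union f₂, ?_, Set.sUnion_union S₁ S₂ |>.symm⟩
  rintro E (hE | hE)
  · exact e₁ E hE
  · exact e₂ E hE

theorem isAlgebraicSubset_empty {G : Type u} [AddGroup G] :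
    IsAlgebraicSubset (∅ : Set G) := by
  refine ⟨{∅}, ?_, by simp⟩
  rintro F rfl
  exact ⟨∅, Set.finite_empty, by simp, by simp⟩

theorem isAlgebraicSubset_sInter {G : Type u} [AddGroup G] {𝒜 : Set (Set G)}
    (h : ∀ A ∈ 𝒜, IsAlgebraicSubset A) : IsAlgebraicSubset (⋂₀ 𝒜) := by
  refine ⟨{F | IsFiniteUnionElementary F ∧ ⋂₀ 𝒜 ⊆ F}, fun F hF => hF.1, ?_⟩
  refine Set.Subset.antisymm (fun x hx F hF => hF.2 hx) (fun x hx A hA => ?_)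
  obtain ⟨C, hC, hAC⟩ := h A hA
  rw [hAC]
  intro F hF
  refine hx F ⟨hC F hF, fun y hy => ?_⟩
  have hyA := hy A hA
  rw [hAC] at hyA
  exact hyA F hF

theorem IsAlgebraicSubset.union {G : Type u} [AddGroup G] {A B : Set G}
    (hA : IsAlgebraicSubset A) (hB : IsAlgebraicSubset B) : IsAlgebraicSubset (A ∪ B) := by
  obtain ⟨C, hC, rfl⟩ := hA
  obtain ⟨D, hD, rfl⟩ := hB
  refine ⟨{F | ∃ F₁ ∈ C, ∃ F₂ ∈ D, F = F₁ ∪ F₂}, ?_, ?_⟩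
  · rintro F ⟨F₁, h₁, F₂, h₂, rfl⟩
    exact (hC F₁ h₁).union (hD F₂ h₂)
  · refine Set.Subset.antisymm ?_ (fun x hx => ?_)
    · rintro x hx F ⟨F₁, h₁, F₂, h₂, rfl⟩
      exact hx.imp (fun h => h F₁ h₁) (fun h => h F₂ h₂)
    · by_contra hne
      simp only [Set.mem_union, Set.mem_sInter, not_or, not_forall] at hne
      obtain ⟨⟨F₁, h₁, n₁⟩, ⟨F₂, h₂, n₂⟩⟩ := hne
      exact (hx _ ⟨F₁, h₁, F₂, h₂, rfl⟩).elim n₁ n₂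

/-- The Zariski topology of `G`: its closed sets are exactly the algebraic subsets of `G`. -/
abbrev zariskiTopology (G : Type u) [AddGroup G] : TopologicalSpace G :=
  TopologicalSpace.ofClosed {A : Set G | IsAlgebraicSubset A} isAlgebraicSubset_empty
    (fun _ h => isAlgebraicSubset_sInter h) (fun _ hA _ hB => IsAlgebraicSubset.union hA hB)

theorem isClosed_zariskiTopology_iff {G : Type u} [AddGroup G] {A : Set G} :
    @IsClosed G (zariskiTopology G) A ↔ IsAlgebraicSubset A := by
  rw [← @isOpen_compl_iff G A (zariskiTopology G)]
  change IsAlgebraicSubset Aᶜᶜ ↔ _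
  rw [compl_compl]

/-- `X` is potentially dense in `G`: it is dense in some Hausdorff group topology on `G`. -/
def IsPotentiallyDense {G : Type u} [AddGroup G] (X : Set G) : Prop :=
  ∃ t : TopologicalSpace G, @IsTopologicalAddGroup G t _ ∧ @T2Space G t ∧ @Dense G t X

/-- A topological group is precompact if it is isomorphic, as a topological group, to a subgroup of
some compact Hausdorff group, i.e. it has an injective homomorphism into one that is a homeomorphism
onto its image. -/
def IsPrecompactGroup (G : Type u) [AddGroup G] [TopologicalSpace G] : Prop :=
  ∃ (K : Type u) (_ : AddGroup K) (_ : TopologicalSpace K) (_ : IsTopologicalAddGroup K)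
    (_ : CompactSpace K) (_ : T2Space K) (φ : G →+ K), Topology.IsEmbedding φ

/-- A precompact metric group topology on `G`: a group topology that is induced by some metric on
`G` and makes `G` a precompact group. -/
def IsPrecompactMetricGroupTopology {G : Type u} [AddGroup G] (t : TopologicalSpace G) : Prop :=
  @IsTopologicalAddGroup G t _ ∧ @TopologicalSpace.MetrizableSpace G t ∧ @IsPrecompactGroup G _ t

end MarkovZariski

/-! ### Zariski closed sets and group topologies -/

namespace MarkovZariski

open scoped Pointwise

universe u

/-! Algebraic sets are closed in every Hausdorff group topology, so potential density implies
Zariski density. The substance is to build a precompact metric topology from Zariski density, by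
embedding `G` in `𝕋^ℕ`.

Let `n` generate the ideal of integers `k` with `kG` finite. Then `nG` is finite, so `G[n]` has
finitely many cosets. By B. H. Neumann's covering lemma, Zariski density puts into each coset `r +
G[n]` a sequence `x_j` of `X` whose `k`-multiples are eventually distinct for every `k ∉ nℤ`
(`exists_isAlmostTorsionSeq`).

All these data generate a countable subgroup `H`. A Haar-random point of the compact group `Hom(H,
𝕋^ℕ)` is almost surely injective and almost surely makes each `x_j - r` approximate all of `𝕋^ℕ[n]`
(`exists_injective_hom_forall_mem_closure`); both facts rest on Bessel's inequality for characters.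
Since `|G| ≤ 𝔠`, the embedding of `H` extends to an embedding `φ` of `G`
(`exists_injective_extension`). For `g ∈ r + G[n]`, the point `φ g - φ r` is killed by `n`, hence is
a limit of points `φ (x_j - r)`, and `φ g` is a limit of points of `φ(X)`. The induced topology is
the one sought. -/

theorem IsElementaryAlgebraic.isClosed {G : Type u} [AddGroup G] [TopologicalSpace G]
    [IsTopologicalAddGroup G] [T1Space G] {E : Set G} (hE : IsElementaryAlgebraic E) :
    IsClosed E := by
  obtain ⟨n, a, ε, -, -, rfl⟩ := hE
  have hc : Continuous fun x : G => (List.ofFn fun i => ε i • x + a i).sum := by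
    simp_rw [List.ofFn_eq_map]
    exact continuous_list_sum _ fun i _ => (continuous_id.zsmul (ε i)).add continuous_const
  exact isClosed_singleton.preimage hc

theorem IsAlgebraicSubset.isClosed {G : Type u} [AddGroup G] [TopologicalSpace G]
    [IsTopologicalAddGroup G] [T1Space G] {A : Set G} (hA : IsAlgebraicSubset A) :
    IsClosed A := by
  obtain ⟨C, hC, rfl⟩ := hA
  refine isClosed_sInter fun F hF => ?_
  obtain ⟨S, hS, hE, rfl⟩ := hC F hF
  rw [Set.sUnion_eq_biUnion]
  exact hS.isClosed_biUnion fun E h => (hE E h).isClosed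

theorem closure_zariskiTopology_eq_univ_iff {G : Type u} [AddGroup G] {X : Set G} :
    @closure G (zariskiTopology G) X = Set.univ ↔
      ∀ A : Set G, IsAlgebraicSubset A → X ⊆ A → A = Set.univ := by
  let _ := zariskiTopology G
  constructor
  · intro h A hA hXA
    have := closure_minimal hXA (isClosed_zariskiTopology_iff.2 hA)
    exact Set.univ_subset_iff.1 (h ▸ this)
  · intro h
    exact h _ (isClosed_zariskiTopology_iff.1 isClosed_closure) subset_closure

theorem IsPotentiallyDense.closure_zariskiTopology {G : Type u} [AddGroup G] {X : Set G}
    (hX : IsPotentiallyDense X) : @closure G (zariskiTopology G) X = Set.univ := by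
  obtain ⟨t, _, _, hd⟩ := hX
  rw [closure_zariskiTopology_eq_univ_iff]
  intro A hA hXA
  have h := closure_minimal hXA hA.isClosed
  rw [hd.closure_eq] at h
  exact Set.univ_subset_iff.1 h

theorem IsFiniteUnionElementary.isAlgebraicSubset {G : Type u} [AddGroup G] {F : Set G}
    (hF : IsFiniteUnionElementary F) : IsAlgebraicSubset F :=
  ⟨{F}, by rintro _ rfl; exact hF, by simp⟩

/-! ### Zariski dense subsets of abelian groups and almost torsion sequences -/

variable {G : Type u} [AddCommGroup G]

theorem isElementaryAlgebraic_nsmul_eq {k : ℕ} (hk : 0 < k) (g : G) :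
    IsElementaryAlgebraic {x : G | k • x = g} := by
  obtain ⟨m, rfl⟩ := Nat.exists_eq_succ_of_ne_zero hk.ne'
  refine ⟨m + 1, fun i => if i = Fin.last m then -g else 0, fun _ => 1, m.succ_pos,
    fun _ => Or.inr rfl, ?_⟩
  ext x
  have : (∑ i : Fin (m + 1), if i = Fin.last m then -g else 0) = -g := by simp
  simp only [one_smul, List.sum_ofFn, Finset.sum_add_distrib, this, Finset.sum_const,
    Finset.card_univ, Fintype.card_fin, Set.mem_ofPred_eq, add_neg_eq_zero, Nat.succ_eq_add_one]

theorem isFiniteUnionElementary_biUnion_nsmul_eq {s : Set (ℕ × G)} (hs : s.Finite)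
    (hpos : ∀ p ∈ s, 0 < p.1) :
    IsFiniteUnionElementary (⋃ p ∈ s, {x : G | p.1 • x = p.2}) := by
  refine ⟨(fun p : ℕ × G => {x : G | p.1 • x = p.2}) '' s, hs.image _, ?_, ?_⟩
  · rintro _ ⟨p, hp, rfl⟩
    exact isElementaryAlgebraic_nsmul_eq (hpos p hp) p.2
  · rw [Set.sUnion_image]

variable (G) in
theorem exists_nat_finite_range_zsmul_iff_dvd :
    ∃ n : ℕ, ∀ k : ℤ, (Set.range fun x : G => k • x).Finite ↔ (n : ℤ) ∣ k := by
  let I : Ideal ℤ :=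
    { carrier := {k | (Set.range fun x : G => k • x).Finite}
      zero_mem' := by
        refine (Set.finite_singleton (0 : G)).subset ?_
        rintro _ ⟨x, rfl⟩
        simp
      add_mem' := by
        intro a b ha hb
        refine (Set.Finite.image2 (fun x y => x + y) ha hb).subset ?_
        rintro _ ⟨x, rfl⟩
        exact ⟨a • x, ⟨x, rfl⟩, b • x, ⟨x, rfl⟩, (add_smul a b x).symm⟩
      smul_mem' := by
        intro c a ha
        refine (Set.Finite.image (fun y => c • y) ha).subset ?_
        rintro _ ⟨x, rfl⟩
        exact ⟨a • x, ⟨x, rfl⟩, by simp [mul_smul]⟩ }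
  obtain ⟨d, hd⟩ := (IsPrincipalIdealRing.principal I).principal
  refine ⟨d.natAbs, fun k => ?_⟩
  change k ∈ I ↔ _
  rw [hd, Ideal.submodule_span_eq, Ideal.mem_span_singleton, Int.natAbs_dvd]

/-- The sets in the cover are cosets of kernels of multiplications. By B. H. Neumann's lemma one
kernel has finite index, and its quotient is the corresponding range. -/
theorem finite_range_zsmul_of_cover {s : Finset (ℤ × G)}
    (hs : ∀ x : G, ∃ p ∈ s, p.1 • (x - p.2) = 0) :
    ∃ p ∈ s, (Set.range fun x : G => p.1 • x).Finite := by
  have hcov : ⋃ p ∈ s, p.2 +ᵥ ((zsmulAddGroupHom (α := G) p.1).ker : Set G) = Set.univ := by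
    refine Set.eq_univ_of_forall fun x => ?_
    obtain ⟨p, hp, h⟩ := hs x
    refine Set.mem_biUnion hp (Set.mem_vadd_set.2 ⟨x - p.2, ?_, by simp⟩)
    simpa using h
  obtain ⟨p, hp, hfin⟩ := AddSubgroup.exists_finiteIndex_of_leftCoset_cover hcov
  refine ⟨p, hp, ?_⟩
  have : Finite (G ⧸ (zsmulAddGroupHom (α := G) p.1).ker) :=
    AddSubgroup.finite_quotient_of_finiteIndex
  have := Finite.of_equiv _
    (QuotientAddGroup.quotientKerEquivRange (zsmulAddGroupHom (α := G) p.1)).toEquiv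
  exact Set.toFinite ((zsmulAddGroupHom (α := G) p.1).range : Set G)

/-- Otherwise `X`, and by density `G`, is covered by the cosets of `G[n]` other than `a + G[n]`
together with finitely many sets `p.2 + G[p.1]`. The latter cover `a + G[n]`, and their translates
by coset representatives cover `G`; so some `p.1 • G` is finite and `n ∣ p.1`. -/
theorem exists_mem_of_closure_zariskiTopology {X : Set G}
    (hX : @closure G (zariskiTopology G) X = Set.univ) {n : ℕ}
    (hn : ∀ k : ℤ, (Set.range fun x : G => k • x).Finite ↔ (n : ℤ) ∣ k) (a : G)
    (s : Set (ℕ × G)) (hfin : s.Finite) (hs : ∀ p ∈ s, ¬ n ∣ p.1) :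
    ∃ x ∈ X, n • (x - a) = 0 ∧ ∀ p ∈ s, p.1 • (x - p.2) ≠ 0 := by
  by_contra! hcon
  have hrange : (Set.range fun x : G => n • x).Finite := by
    simpa using (hn n).2 dvd_rfl
  let s₁ : Set (ℕ × G) := (fun p => (p.1, p.1 • p.2)) '' s
  let s₂ : Set (ℕ × G) := (fun v => (n, v)) '' ((Set.range fun x : G => n • x) \ {n • a})
  have hpos : ∀ p ∈ s₁ ∪ s₂, 0 < p.1 := by
    rintro _ (⟨p, hp, rfl⟩ | ⟨v, ⟨⟨x, rfl⟩, hv⟩, rfl⟩)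
    · refine Nat.pos_of_ne_zero fun h => hs p hp ?_
      exact h ▸ dvd_zero n
    · refine Nat.pos_of_ne_zero fun (h : n = 0) => hv ?_
      simp [h]
  have huniv := closure_zariskiTopology_eq_univ_iff.1 hX _
    (isFiniteUnionElementary_biUnion_nsmul_eq
      ((hfin.image _).union ((hrange.subset Set.sdiff_subset).image _)) hpos).isAlgebraicSubset (by
      intro x hx
      by_cases hxa : n • (x - a) = 0
      · obtain ⟨p, hp, h⟩ := hcon x hx hxa
        refine Set.mem_biUnion (Or.inl ⟨p, hp, rfl⟩) ?_
        simpa [smul_sub, sub_eq_zero] using h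
      · refine Set.mem_biUnion (x := (n, n • x)) (Or.inr ⟨n • x, ⟨⟨x, rfl⟩, ?_⟩, rfl⟩) rfl
        simpa [smul_sub, sub_eq_zero] using hxa)
  choose r hr using fun v : Set.range (fun x : G => n • x) => v.2
  have := hrange.to_subtype
  have hrfin : (Set.range r).Finite := Set.finite_range r
  let S : Set (ℤ × G) := Set.image2 (fun p b => ((p.1 : ℤ), p.2 + (b - a))) s (Set.range r)
  have hSfin : S.Finite := hfin.image2 _ hrfin
  obtain ⟨p, hp, hpf⟩ := finite_range_zsmul_of_cover (s := hSfin.toFinset) (fun x => by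
    let b := r ⟨n • x, x, rfl⟩
    have hb : n • b = n • x := hr ⟨n • x, x, rfl⟩
    have hy : x - b + a ∈ (Set.univ : Set G) := trivial
    rw [← huniv] at hy
    simp only [Set.mem_iUnion] at hy
    obtain ⟨_, (⟨p, hp, rfl⟩ | ⟨v, ⟨_, hv⟩, rfl⟩), h⟩ := hy
    · refine ⟨((p.1 : ℤ), p.2 + (b - a)), ?_, ?_⟩
      · rw [Set.Finite.mem_toFinset]
        exact ⟨p, hp, b, ⟨_, rfl⟩, rfl⟩
      · have h' : p.1 • (x - b + a) = p.1 • p.2 := h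
        have : x - (p.2 + (b - a)) = (x - b + a) - p.2 := by abel
        simp [this, smul_sub p.1 _ p.2, h']
    · have h' : n • (x - b + a) = v := h
      refine absurd ?_ hv
      rw [← h', smul_add, smul_sub, hb]
      simp)
  rw [Set.Finite.mem_toFinset] at hp
  obtain ⟨q, hq, b, -, rfl⟩ := hp
  exact hs q hq (Int.natCast_dvd_natCast.1 ((hn _).1 hpf))

/-- A sequence whose multiples by any integer outside `nℤ` are eventually pairwise distinct. -/
def IsAlmostTorsionSeq (n : ℕ) (x : ℕ → G) : Prop :=
  ∀ k : ℤ, ¬ (n : ℤ) ∣ k → ∃ J, ∀ i ≥ J, ∀ j ≥ J, k • x i = k • x j → i = j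

theorem exists_isAlmostTorsionSeq {X : Set G}
    (hX : @closure G (zariskiTopology G) X = Set.univ) {n : ℕ}
    (hn : ∀ k : ℤ, (Set.range fun x : G => k • x).Finite ↔ (n : ℤ) ∣ k) (a : G) :
    ∃ x : ℕ → G, (∀ j, x j ∈ X) ∧ (∀ j, n • (x j - a) = 0) ∧ IsAlmostTorsionSeq n x := by
  obtain ⟨f, hf, hr⟩ := exists_seq_of_forall_finset_exists
    (fun p : ℕ × G => p.2 ∈ X ∧ n • (p.2 - a) = 0)
    (fun p q => p.1 < q.1 ∧ ∀ k ≤ q.1, ¬ n ∣ k → k • (q.2 - p.2) ≠ 0) (by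
      intro s _
      -- The first coordinate is a strictly increasing counter bounding the multipliers treated so
      -- far, so each fixed `k` is eventually covered.
      let j := s.sup Prod.fst + 1
      let S : Set (ℕ × G) := Set.image2 (fun (k : ℕ) (p : ℕ × G) => (k, p.2)) {k | k ≤ j ∧ ¬ n ∣ k} s
      obtain ⟨x, hx, hxa, h⟩ := exists_mem_of_closure_zariskiTopology hX hn a S
        (((Set.finite_le_nat j).subset fun k hk => hk.1).image2 _ s.finite_toSet) (by
          rintro _ ⟨k, hk, p, hp, rfl⟩
          exact hk.2)
      refine ⟨(j, x), ⟨hx, hxa⟩, fun p hp => ⟨Nat.lt_succ_of_le (Finset.le_sup hp), ?_⟩⟩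
      intro k hk hnk
      exact h (k, p.2) ⟨k, ⟨hk, hnk⟩, p, hp, rfl⟩)
  have hmono : StrictMono fun j => (f j).1 := fun i j hij => (hr i j hij).1
  refine ⟨fun j => (f j).2, fun j => (hf j).1, fun j => (hf j).2, fun k hk => ⟨k.natAbs, ?_⟩⟩
  have key : ∀ i j, k.natAbs ≤ j → i < j → k • (f i).2 ≠ k • (f j).2 := by
    intro i j hj hij h
    refine (hr i j hij).2 k.natAbs (hj.trans (hmono.id_le j))
      (fun hd => hk (Int.natCast_dvd.2 hd)) ?_
    have h0 : k • ((f j).2 - (f i).2) = 0 := by rw [smul_sub, h, sub_self]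
    rw [← natCast_zsmul]
    rcases Int.natAbs_eq k with h1 | h1
    · rwa [← h1]
    · rw [h1, neg_smul, neg_eq_zero] at h0
      exact h0
  intro i hi j hj h
  rcases lt_trichotomy i j with hij | hij | hij
  · exact absurd h (key i j hj hij)
  · exact hij
  · exact absurd h.symm (key j i hi hij)

end MarkovZariski

/-! ### Extending embeddings into `𝕋^ℕ` -/

namespace MarkovZariski

universe u

open Cardinal in
theorem mk_span_int_lt_continuum {G : Type u} [AddCommGroup G] {s : Set G}
    (hs : #s < continuum.{u}) : #(Submodule.span ℤ s) < continuum.{u} := by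
  have hsurj : Function.Surjective
      (fun f : s →₀ ℤ => (⟨Finsupp.linearCombination ℤ ((↑) : s → G) f, by
        exact (Finsupp.mem_span_iff_linearCombination ℤ s _).2 ⟨f, rfl⟩⟩ : Submodule.span ℤ s)) := by
    rintro ⟨x, hx⟩
    obtain ⟨f, hf⟩ := (Finsupp.mem_span_iff_linearCombination ℤ s x).1 hx
    exact ⟨f, Subtype.ext hf⟩
  refine (mk_le_of_surjective hsurj).trans_lt ?_
  rcases isEmpty_or_nonempty s with h | h
  · rw [mk_fintype]
    exact (natCast_lt_aleph0 (n := Fintype.card _)).trans aleph0_lt_continuum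
  · rw [mk_finsupp_lift_of_infinite' s ℤ]
    simp [hs, aleph0_lt_continuum]

theorem exists_addOrderOf_unitAddCircle_eq (m : ℕ) : ∃ θ : UnitAddCircle, addOrderOf θ = m := by
  rcases Nat.eq_zero_or_pos m with rfl | hm
  · refine ⟨((√2 : ℝ) : UnitAddCircle), addOrderOf_eq_zero_iff'.2 fun k hk h => ?_⟩
    rw [← AddCircle.coe_nsmul, AddCircle.coe_eq_zero_iff] at h
    obtain ⟨z, hz⟩ := h
    have := (irrational_sqrt_two.natCast_mul hk.ne').ne_int z
    simp at hz this
    exact this hz.symm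
  · exact ⟨_, AddCircle.addOrderOf_period_div (p := (1 : ℝ)) hm⟩

section Extension

variable {G : Type u} [AddCommGroup G]

theorem exists_nat_zsmul_mem_iff_dvd (H : Submodule ℤ G) (g : G) :
    ∃ m : ℕ, ∀ c : ℤ, c • g ∈ H ↔ (m : ℤ) ∣ c := by
  let I : Ideal ℤ := H.comap (LinearMap.toSpanSingleton ℤ G g)
  obtain ⟨d, hd⟩ := (IsPrincipalIdealRing.principal I).principal
  refine ⟨d.natAbs, fun c => ?_⟩
  change c ∈ I ↔ _
  rw [hd, Ideal.submodule_span_eq, Ideal.mem_span_singleton, Int.natAbs_dvd]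

open Cardinal in
/-- Over a subgroup of size less than the continuum, a root in `𝕋^ℕ` of any order can be chosen
outside of the subgroup as far as possible. -/
theorem exists_root_of_mk_lt_continuum {H : Type u} [AddCommGroup H] (hH : #H < continuum.{u})
    (f : H →+ (ℕ → UnitAddCircle)) (m : ℕ) (h : H) (hm : m = 0 → h = 0) :
    ∃ y : ℕ → UnitAddCircle, m • y = f h ∧ ∀ c : ℤ, ∀ d : H, c • y = f d → (m : ℤ) ∣ c := by
  obtain ⟨θ, hθ⟩ := exists_addOrderOf_unitAddCircle_eq m
  obtain ⟨y₀, hy₀⟩ : ∃ y₀ : ℕ → UnitAddCircle, m • y₀ = f h := by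
    rcases Nat.eq_zero_or_pos m with rfl | hpos
    · exact ⟨0, by simp [hm rfl]⟩
    · refine ⟨fun i => DivisibleBy.div (f h i) (m : ℤ), funext fun i => ?_⟩
      have := DivisibleBy.div_cancel (f h i) (Int.natCast_ne_zero.2 hpos.ne')
      simpa using this
  -- Continuum many roots, one per binary sequence. A bad root is witnessed by a pair in `ℤ × H`;
  -- two bad roots with the same pair would give `c • θ = 0`, hence `m ∣ c`. There are too few pairs
  -- for all roots to be bad.
  let y : (ℕ → Bool) → ℕ → UnitAddCircle := fun s i => y₀ i + if s i then θ else 0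
  have hmθ : m • θ = 0 := by rw [← hθ]; exact addOrderOf_nsmul_eq_zero θ
  have hy : ∀ s, m • y s = f h := by
    intro s
    rw [← hy₀]
    ext i
    by_cases hs : s i <;> simp [y, hs, hmθ]
  by_contra! hcon
  choose c d hcd hndvd using fun s => hcon (y s) (hy s)
  have hinj : Function.Injective fun s => (c s, d s) := by
    intro s t hst
    simp only [Prod.mk.injEq] at hst
    by_contra hne
    obtain ⟨i, hi⟩ := Function.ne_iff.1 hne
    have h1 : (c s • y s) i = (c s • y t) i := by
      rw [hcd s, hst.1, hcd t, hst.2]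
    have h2 : c s • θ = 0 := by
      cases hs : s i <;> cases ht : t i <;> simp_all [y]
    exact hndvd s (hθ ▸ addOrderOf_dvd_iff_zsmul_eq_zero.2 h2)
  have hle := lift_mk_le_lift_mk_of_injective hinj
  have hlt : #(ℤ × H) < continuum.{u} := by
    rw [mk_prod]
    exact mul_lt_of_lt aleph0_le_continuum (by simp [aleph0_lt_continuum]) (by simpa using hH)
  refine absurd hle (not_le.2 ?_)
  simpa using hlt

open Cardinal in
theorem exists_le_of_mk_domain_lt_continuum (f : G →ₗ.[ℤ] (ℕ → UnitAddCircle))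
    (hf : Function.Injective f) (hcard : #f.domain < continuum.{u}) (g : G) :
    ∃ f' : G →ₗ.[ℤ] (ℕ → UnitAddCircle),
      f ≤ f' ∧ Function.Injective f' ∧ f'.domain = f.domain ⊔ Submodule.span ℤ {g} := by
  obtain ⟨m, hm⟩ := exists_nat_zsmul_mem_iff_dvd f.domain g
  have hmg : m • g ∈ f.domain := by simpa using (hm m).2 dvd_rfl
  obtain ⟨y, hy, hdvd⟩ := exists_root_of_mk_lt_continuum hcard f.toFun.toAddMonoidHom m
    ⟨m • g, hmg⟩ (by rintro rfl; simp)
  have hfy : ∀ (c : ℤ) (hc : c • g ∈ f.domain), f ⟨c • g, hc⟩ = c • y := by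
    intro c hc
    obtain ⟨k, rfl⟩ := (hm c).1 hc
    have : (⟨((m : ℤ) * k) • g, hc⟩ : f.domain) = k • ⟨m • g, hmg⟩ := by
      ext
      simp [mul_comm (m : ℤ) k, mul_smul]
    rw [this, f.map_smul, mul_comm, mul_smul, natCast_zsmul, hy]
    rfl
  let p : G →ₗ.[ℤ] (ℕ → UnitAddCircle) := LinearPMap.mkSpanSingleton' g y (by
    intro c hc
    have := hfy c (hc ▸ f.domain.zero_mem)
    simp only [eq_intCast, Int.cast_eq]
    rw [← this]
    simp only [hc]
    exact f.map_zero)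
  have hcompat : ∀ (x : f.domain) (z : p.domain), (x : G) = z → f x = p z := by
    rintro ⟨x, hx⟩ ⟨z, hz⟩ (rfl : x = z)
    obtain ⟨c, rfl⟩ := Submodule.mem_span_singleton.1 hz
    rw [hfy c hx]
    exact (LinearPMap.mkSpanSingleton'_apply g y _ c hz).symm
  refine ⟨f.sup p hcompat, LinearPMap.left_le_sup _ _ _, ?_, rfl⟩
  refine (injective_iff_map_eq_zero' (f.sup p hcompat).toFun).2 ?_
  intro z
  refine ⟨fun hz => ?_, fun hz => by rw [hz]; exact map_zero _⟩
  obtain ⟨x, hx, w, hw, hxw⟩ := Submodule.mem_sup.1 z.2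
  obtain ⟨c, rfl⟩ := Submodule.mem_span_singleton.1 hw
  have hval : f.sup p hcompat z = f ⟨x, hx⟩ + c • y := by
    rw [LinearPMap.sup_apply hcompat ⟨x, hx⟩ ⟨c • g, hw⟩ z hxw]
    congr 1
    exact LinearPMap.mkSpanSingleton'_apply g y _ c hw
  have h0 : f ⟨x, hx⟩ + c • y = 0 := hval ▸ hz
  -- The choice of `y` forces any kernel element into the old domain, where `f` is injective.
  have hc : c • g ∈ f.domain := (hm c).2 (hdvd c (-⟨x, hx⟩) (by
    rw [eq_neg_of_add_eq_zero_right h0]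
    exact (f.map_neg _).symm))
  rw [← hfy c hc, ← f.map_add] at h0
  have h1 := hf (h0.trans f.map_zero.symm)
  ext
  rw [← hxw]
  exact congrArg Subtype.val h1

open Cardinal in
theorem exists_injective_extension (hG : #G ≤ continuum.{u})
    (f : G →ₗ.[ℤ] (ℕ → UnitAddCircle)) (hf : Function.Injective f)
    (hcard : #f.domain < continuum.{u}) :
    ∃ φ : G →+ (ℕ → UnitAddCircle), Function.Injective φ ∧ ∀ x : f.domain, φ x = f x := by
  -- In a well-order of minimal type, proper initial segments have fewer than `|G| ≤ 𝔠` elements.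
  -- Restricting Zorn's lemma to domains generated over `f.domain` by lower sets keeps every proper
  -- stage below the continuum.
  obtain ⟨_, _, hord⟩ := exists_ord_eq_type_lt G
  let S : Set (G →ₗ.[ℤ] (ℕ → UnitAddCircle)) := {f' | Function.Injective f' ∧
    ∃ I : Set G, IsLowerSet I ∧ f'.domain = f.domain ⊔ Submodule.span ℤ I}
  obtain ⟨F, hfF, ⟨hFinj, I, hI, hFI⟩, hmax⟩ := zorn_le_nonempty₀ S (by
    intro C hCS hC F₀ hF₀
    have hdir := hC.directedOn
    refine ⟨LinearPMap.sSup C hdir, ⟨?_, ?_⟩, fun z hz => LinearPMap.le_sSup hdir hz⟩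
    · rintro ⟨x, hx⟩ ⟨y, hy⟩ hxy
      obtain ⟨A, hA, hxA⟩ := (LinearPMap.mem_domain_sSup_iff ⟨F₀, hF₀⟩ hdir).1 hx
      obtain ⟨B, hB, hyB⟩ := (LinearPMap.mem_domain_sSup_iff ⟨F₀, hF₀⟩ hdir).1 hy
      obtain ⟨D, hD, hAD, hBD⟩ := hdir A hA B hB
      rw [LinearPMap.sSup_apply hdir hD ⟨x, hAD.1 hxA⟩,
        LinearPMap.sSup_apply hdir hD ⟨y, hBD.1 hyB⟩] at hxy
      have := (hCS hD).1 hxy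
      simpa using this
    · choose! J hJ hCJ using fun A hA => (hCS (a := A) hA).2
      refine ⟨⋃ A ∈ C, J A, isLowerSet_iUnion₂ hJ, le_antisymm ?_ ?_⟩
      · intro x hx
        obtain ⟨A, hA, hxA⟩ := (LinearPMap.mem_domain_sSup_iff ⟨F₀, hF₀⟩ hdir).1 hx
        rw [hCJ A hA] at hxA
        have hJA := Submodule.span_mono (R := ℤ) (Set.subset_biUnion_of_mem (u := J) hA)
        exact sup_le_sup_left hJA f.domain hxA
      · refine sup_le ?_ (Submodule.span_le.2 (Set.iUnion₂_subset fun A hA => ?_))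
        · refine le_trans ?_ (LinearPMap.le_sSup hdir hF₀).1
          rw [hCJ F₀ hF₀]
          exact le_sup_left
        · refine Set.Subset.trans ?_ (LinearPMap.le_sSup hdir hA).1
          rw [hCJ A hA]
          exact Set.Subset.trans Submodule.subset_span
            (le_sup_right (a := f.domain) (b := Submodule.span ℤ (J A))))
    f ⟨hf, ∅, isLowerSet_empty, by simp⟩
  have htop : ∀ g, g ∈ F.domain := by
    by_contra! hne
    obtain ⟨g, hg, hmin⟩ := WellFounded.has_min (wellFounded_lt (α := G))
      {g | g ∉ F.domain} hne
    have hlt : ∀ x < g, x ∈ F.domain := fun x hx => by_contra fun h => hmin x h hx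
    have hIg : I ⊆ Set.Iio g := fun x hx => by
      by_contra hgx
      exact hg (hFI ▸ Submodule.mem_sup_right (Submodule.subset_span (hI (not_lt.1 hgx) hx)))
    have hIio : F.domain = f.domain ⊔ Submodule.span ℤ (Set.Iio g) := by
      refine le_antisymm ?_ (sup_le hfF.1 (Submodule.span_le.2 hlt))
      rw [hFI]
      exact sup_le_sup_left (Submodule.span_mono hIg) _
    have hFcard : #F.domain < continuum.{u} := by
      have : F.domain = Submodule.span ℤ ((f.domain : Set G) ∪ Set.Iio g) := by
        rw [hIio, Submodule.span_union, Submodule.span_eq]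
      rw [this]
      refine mk_span_int_lt_continuum ((mk_union_le _ _).trans_lt
        (add_lt_of_lt aleph0_le_continuum hcard ?_))
      exact (card_typein_lt g hord).trans_le hG
    obtain ⟨F', hle, hinj, hdom⟩ := exists_le_of_mk_domain_lt_continuum F hFinj hFcard g
    have hF' : F' ∈ S := by
      refine ⟨hinj, Set.Iic g, isLowerSet_Iic g, ?_⟩
      rw [hdom, hIio, sup_assoc, ← Submodule.span_union, Set.union_singleton, Set.Iio_insert]
    exact hg ((hmax hF' hle).1 (hdom ▸ Submodule.mem_sup_right
      (Submodule.mem_span_singleton_self g)))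
  refine ⟨(F.toFun.comp (LinearMap.codRestrict F.domain LinearMap.id htop)).toAddMonoidHom, ?_, ?_⟩
  · intro x y hxy
    exact congrArg Subtype.val (hFinj hxy)
  · intro x
    exact (hfF.2 rfl).symm

end Extension

end MarkovZariski

/-! ### Bessel's inequality for characters -/

namespace MarkovZariski

universe u

open MeasureTheory Filter Topology

section Bessel

variable {C : Type*} [AddCommGroup C] [TopologicalSpace C] [MeasurableSpace C] [BorelSpace C]
  (μ : Measure C)

theorem memLp_toCircle [IsFiniteMeasure μ] (c : C →+ UnitAddCircle) (hc : Continuous c) :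
    MemLp (fun x => ((c x).toCircle : ℂ)) 2 μ :=
  MemLp.of_bound (Continuous.aestronglyMeasurable (by fun_prop)) 1
    (Eventually.of_forall fun x => (Circle.norm_coe (c x).toCircle).le)

variable [IsTopologicalAddGroup C] [μ.IsAddLeftInvariant]

/-- Translation by `a` with `c a ≠ 0` multiplies the integral by a number other than `1`. -/
theorem integral_toCircle_eq_zero (c : C →+ UnitAddCircle) (hne : c ≠ 0) :
    ∫ x, ((c x).toCircle : ℂ) ∂μ = 0 := by
  obtain ⟨a, ha⟩ := DFunLike.ne_iff.1 hne
  have h := integral_add_left_eq_self (μ := μ) (fun x => ((c x).toCircle : ℂ)) a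
  simp only [map_add, AddCircle.toCircle_add, Circle.coe_mul, integral_const_mul] at h
  have h1 : ((c a).toCircle : ℂ) ≠ 1 := by
    intro h1
    refine ha (AddCircle.injective_toCircle one_ne_zero ?_)
    rw [AddMonoidHom.zero_apply, AddCircle.toCircle_zero]
    exact Circle.coe_eq_one.1 h1
  have h2 := sub_eq_zero.2 h
  rw [← sub_one_mul] at h2
  exact (mul_eq_zero.1 h2).resolve_left (sub_ne_zero.2 h1)

variable [IsProbabilityMeasure μ]

theorem orthonormal_toCircle {c : ℕ → C →+ UnitAddCircle} (hc : ∀ j, Continuous (c j))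
    (hinj : Function.Injective c) :
    Orthonormal ℂ fun j => (memLp_toCircle μ (c j) (hc j)).toLp := by
  rw [orthonormal_iff_ite]
  intro i j
  have h : inner ℂ (memLp_toCircle μ (c i) (hc i)).toLp (memLp_toCircle μ (c j) (hc j)).toLp =
      ∫ x, (((c j - c i) x).toCircle : ℂ) ∂μ := by
    rw [L2.inner_def]
    refine integral_congr_ae ?_
    filter_upwards [(memLp_toCircle μ (c i) (hc i)).coeFn_toLp,
      (memLp_toCircle μ (c j) (hc j)).coeFn_toLp] with x hi hj
    rw [hi, hj]
    simp [sub_eq_add_neg, AddCircle.toCircle_add, AddCircle.toCircle_neg,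
      ← Circle.coe_inv_eq_conj]
  rw [h]
  split_ifs with hij
  · simp [hij]
  · exact integral_toCircle_eq_zero μ _ (sub_ne_zero.2 fun h => hij (hinj h).symm)

/-- These integrals are the inner products of the indicator of `V` with characters that are
orthonormal from index `J` on, so their squares are summable. -/
theorem tendsto_setIntegral_toCircle {c : ℕ → C →+ UnitAddCircle} (hc : ∀ j, Continuous (c j))
    {J : ℕ} (hinj : ∀ i ≥ J, ∀ j ≥ J, c i = c j → i = j) {V : Set C} (hV : MeasurableSet V) :
    Tendsto (fun j => ∫ x in V, ((c j x).toCircle : ℂ) ∂μ) atTop (𝓝 0) := by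
  rw [← tendsto_add_atTop_iff_nat J]
  have horth := orthonormal_toCircle μ (c := fun j => c (j + J)) (fun j => hc _)
    (fun i j h => by simpa using hinj _ (by simp) _ (by simp) h)
  have hsum := (horth.inner_products_summable
    (indicatorConstLp 2 hV (measure_ne_top μ V) (1 : ℂ))).tendsto_atTop_zero
  rw [tendsto_zero_iff_norm_tendsto_zero]
  have hsqrt := hsum.sqrt
  simp only [Real.sqrt_sq (norm_nonneg _), Real.sqrt_zero] at hsqrt
  refine hsqrt.congr fun j => ?_
  rw [norm_inner_symm, L2.inner_indicatorConstLp_one]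
  congr 1
  exact setIntegral_congr_ae hV ((memLp_toCircle μ _ (hc (j + J))).coeFn_toLp.mono
    fun x hx _ => hx)

end Bessel

/-! ### The compact group of homomorphisms to `𝕋^ℕ` -/

section HomSpace

/-- The compact group of homomorphisms from a discrete group to `𝕋^ℕ`, with the topology of
pointwise convergence. -/
def homSpace (H : Type*) [AddCommGroup H] : AddSubgroup (H → ℕ → UnitAddCircle) where
  carrier := {f | ∀ a b, f (a + b) = f a + f b}
  zero_mem' := by simp
  add_mem' := by
    intro f g hf hg a b
    simp only [Pi.add_apply, hf a b, hg a b]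
    abel
  neg_mem' := by
    intro f hf a b
    simp only [Pi.neg_apply, hf a b]
    abel

variable {H : Type u} [AddCommGroup H]

instance : CompactSpace (homSpace H) := by
  refine isCompact_iff_compactSpace.1 (IsClosed.isCompact ?_)
  change IsClosed {f : H → ℕ → UnitAddCircle | ∀ a b, f (a + b) = f a + f b}
  simp only [Set.ofPred_forall]
  exact isClosed_iInter fun a => isClosed_iInter fun b =>
    isClosed_eq (by fun_prop) (by fun_prop)

/-- A point of `homSpace H` as a homomorphism. -/
def homSpace.toHom (φ : homSpace H) : H →+ (ℕ → UnitAddCircle) :=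
  AddMonoidHom.mk' φ.1 φ.2

/-- Evaluation at a point of the discrete group. -/
def homSpace.eval (h : H) : homSpace H →+ (ℕ → UnitAddCircle) where
  toFun φ := homSpace.toHom φ h
  map_zero' := rfl
  map_add' _ _ := rfl

theorem homSpace.continuous_eval (h : H) : Continuous (homSpace.eval h) := by
  change Continuous fun φ : homSpace H => φ.1 h
  exact (continuous_apply (A := fun _ => ℕ → UnitAddCircle) h).comp continuous_subtype_val

open Cardinal in
theorem exists_hom_unitAddCircle_ne_zero (hH : #H ≤ continuum.{u}) {h : H} (hne : h ≠ 0) :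
    ∃ χ : H →+ UnitAddCircle, χ h ≠ 0 := by
  obtain ⟨φ, hφ, -⟩ := exists_injective_extension hH ⊥ (by
    rintro ⟨x, hx⟩ ⟨y, hy⟩ -
    ext
    exact ((Submodule.mem_bot ℤ).1 hx).trans ((Submodule.mem_bot ℤ).1 hy).symm) (by
    change #(⊥ : Submodule ℤ H) < _
    simpa using one_lt_aleph0.trans aleph0_lt_continuum)
  have h1 : φ h ≠ 0 := fun h0 => hne (hφ (h0.trans φ.map_zero.symm))
  obtain ⟨i, hi⟩ := Function.ne_iff.1 h1
  exact ⟨(Pi.evalAddMonoidHom _ i).comp φ, hi⟩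

/-- The homomorphism with a given single nonzero coordinate. -/
def homSpace.single (i : ℕ) (χ : H →+ UnitAddCircle) : homSpace H :=
  ⟨fun h => Pi.single i (χ h), fun a b => by simp only [map_add, Pi.single_add]⟩

theorem homSpace.eval_single (i : ℕ) (χ : H →+ UnitAddCircle) (h : H) :
    homSpace.eval h (homSpace.single i χ) = Pi.single i (χ h) := rfl

variable [MeasurableSpace (homSpace H)] [BorelSpace (homSpace H)] (μ : Measure (homSpace H))
  [IsProbabilityMeasure μ] [μ.IsAddLeftInvariant]

open Cardinal in
-- The coordinates of `φ h` give infinitely many distinct characters of `φ`, all trivial on this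
-- set. Their integrals over it equal its measure and tend to `0`.
theorem homSpace.measure_eval_eq_zero (hH : #H ≤ continuum.{u}) {h : H} (hne : h ≠ 0) :
    μ {φ | homSpace.eval h φ = 0} = 0 := by
  obtain ⟨χ, hχ⟩ := exists_hom_unitAddCircle_ne_zero hH hne
  let c : ℕ → homSpace H →+ UnitAddCircle := fun i =>
    (Pi.evalAddMonoidHom _ i).comp (homSpace.eval h)
  have hc : ∀ i, Continuous (c i) := fun i => (continuous_apply i).comp (continuous_eval h)
  have hV : MeasurableSet {φ | homSpace.eval h φ = 0} :=
    (isClosed_eq (continuous_eval h) continuous_const).measurableSet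
  have hlim := tendsto_setIntegral_toCircle μ hc (J := 0) (fun i _ j _ hij => by
    by_contra hne
    have := DFunLike.congr_fun hij (homSpace.single i χ)
    simp [c, homSpace.eval_single, Pi.single_eq_of_ne (Ne.symm hne), hχ] at this) hV
  have hconst : ∀ i, ∫ φ in {φ | homSpace.eval h φ = 0}, ((c i φ).toCircle : ℂ) ∂μ =
      μ.real {φ | homSpace.eval h φ = 0} := by
    intro i
    rw [setIntegral_congr_fun hV (g := fun _ => (1 : ℂ))]
    · simp
    · intro φ (hφ : homSpace.eval h φ = 0)
      simp [c, hφ]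
  simp only [hconst] at hlim
  have := tendsto_nhds_unique tendsto_const_nhds hlim
  rwa [Complex.ofReal_eq_zero, measureReal_eq_zero_iff] at this

open Cardinal in
-- If `n` divides every `k i`, the integrand is identically `1`. Otherwise, up to a constant factor,
-- the integrands are characters, eventually distinct because the `k i₀ • e j` are.
theorem homSpace.tendsto_setIntegral_character (hH : #H ≤ continuum.{u}) {n : ℕ} {e : ℕ → H}
    (he : ∀ j, n • e j = 0) (hseq : IsAlmostTorsionSeq n e) {u : ℕ → UnitAddCircle}
    (hu : n • u = 0) (I : Finset ℕ) (k : I → ℤ) [Decidable (∀ i, (n : ℤ) ∣ k i)]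
    {V : Set (homSpace H)} (hV : MeasurableSet V) :
    Tendsto (fun j => ∫ φ in V,
        ((∑ i : I, k i • (homSpace.eval (e j) φ i - u i)).toCircle : ℂ) ∂μ) atTop
      (𝓝 (if ∀ i, (n : ℤ) ∣ k i then μ.real V else 0)) := by
  split_ifs with hk
  · refine tendsto_const_nhds.congr fun j => ?_
    have h0 : ∀ φ : homSpace H, ∑ i : I, k i • (homSpace.eval (e j) φ i - u i) = 0 := by
      intro φ
      refine Finset.sum_eq_zero fun i _ => ?_
      obtain ⟨l, hl⟩ := hk i
      have h1 : n • homSpace.eval (e j) φ = 0 := by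
        have : n • (homSpace.toHom φ) (e j) = 0 := by rw [← map_nsmul, he, map_zero]
        exact this
      have h2 : n • (homSpace.eval (e j) φ i - u i) = 0 := by
        rw [smul_sub, ← Pi.smul_apply, h1, ← Pi.smul_apply, hu]
        simp
      rw [hl, mul_comm, mul_smul, natCast_zsmul, h2, smul_zero]
    simp only [h0]
    simp
  · push Not at hk
    obtain ⟨i₀, hi₀⟩ := hk
    obtain ⟨J, hJ⟩ := hseq (k i₀) hi₀
    let c : ℕ → homSpace H →+ UnitAddCircle := fun j =>
      ∑ i : I, k i • (Pi.evalAddMonoidHom _ (i : ℕ)).comp (homSpace.eval (e j))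
    have hcapp : ∀ j φ, c j φ = ∑ i : I, k i • homSpace.eval (e j) φ i := by
      intro j φ
      simp [c]
    have hc : ∀ j, Continuous (c j) := by
      intro j
      have : Continuous fun φ => ∑ i : I, k i • homSpace.eval (e j) φ i :=
        continuous_finsetSum _ fun i _ =>
          ((continuous_apply (i : ℕ)).comp (continuous_eval (e j))).zsmul (k i)
      exact this.congr fun φ => (hcapp j φ).symm
    have hlim := tendsto_setIntegral_toCircle μ hc (J := J) (fun i hi j hj hij => by
      refine hJ i hi j hj ?_
      by_contra hne
      obtain ⟨χ, hχ⟩ := exists_hom_unitAddCircle_ne_zero hH (sub_ne_zero.2 hne)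
      have h1 := DFunLike.congr_fun hij (homSpace.single i₀ χ)
      have h2 : ∀ j, c j (homSpace.single i₀ χ) = k i₀ • χ (e j) := by
        intro j
        rw [hcapp, Finset.sum_eq_single i₀]
        · simp [homSpace.eval_single]
        · intro i _ hi
          have : (i : ℕ) ≠ i₀ := fun h => hi (Subtype.ext h)
          simp [homSpace.eval_single, this]
        · simp
      rw [h2, h2] at h1
      refine hχ ?_
      rw [map_sub, map_zsmul, map_zsmul, h1, sub_self]) hV
    have := hlim.mul_const ((-∑ i : I, k i • u i).toCircle : ℂ)
    rw [zero_mul] at this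
    refine this.congr fun j => ?_
    rw [← integral_mul_const]
    congr 1 with φ
    rw [← Circle.coe_mul, ← AddCircle.toCircle_add, hcapp]
    simp only [smul_sub, Finset.sum_sub_distrib, ← sub_eq_add_neg]

end HomSpace

end MarkovZariski

namespace MarkovZariski

universe u

open MeasureTheory Filter Topology

/-! ### A peaked trigonometric polynomial -/

section Kernel

/-- The trigonometric polynomial `|(1 + e^{2πis}) / 2|²`. -/
noncomputable def peak (s : UnitAddCircle) : ℝ :=
  ‖(1 + (s.toCircle : ℂ)) / 2‖ ^ 2

theorem continuous_peak : Continuous peak := by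
  unfold peak
  fun_prop

theorem peak_nonneg (s : UnitAddCircle) : 0 ≤ peak s := by
  unfold peak
  positivity

theorem peak_le_one (s : UnitAddCircle) : peak s ≤ 1 := by
  refine pow_le_one₀ (norm_nonneg _) ?_
  rw [norm_div, div_le_one (by simp)]
  refine (norm_add_le _ _).trans ?_
  rw [Circle.norm_coe]
  norm_num

theorem coe_peak (s : UnitAddCircle) :
    (peak s : ℂ) = ((-s).toCircle : ℂ) * (1 + (s.toCircle : ℂ)) ^ 2 / 4 := by
  have h : ((-s).toCircle : ℂ) * (s.toCircle : ℂ) = 1 := by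
    rw [← Circle.coe_mul, ← AddCircle.toCircle_add]
    simp
  rw [peak, ← Complex.normSq_eq_norm_sq, ← Complex.mul_conj, map_div₀, map_add, map_one,
    ← Circle.coe_inv_eq_conj, ← AddCircle.toCircle_neg, Complex.conj_ofNat]
  linear_combination (1 / 4 * (-1 - (s.toCircle : ℂ))) * h

theorem eq_zero_of_peak_eq_one {s : UnitAddCircle} (hs : peak s = 1) : s = 0 := by
  have h1 : ‖(1 : ℂ) + s.toCircle‖ = ‖(1 : ℂ)‖ + ‖(s.toCircle : ℂ)‖ := by
    have h := (pow_eq_one_iff_of_nonneg (norm_nonneg _) two_ne_zero).1 hs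
    rw [norm_div, div_eq_one_iff_eq (by simp)] at h
    rw [h, Circle.norm_coe]
    norm_num
  have h2 := sameRay_iff_norm_add.2 h1
  have h3 : (1 : ℂ) = s.toCircle := h2.eq_of_norm_eq (by rw [Circle.norm_coe, norm_one])
  refine AddCircle.injective_toCircle one_ne_zero ?_
  rw [AddCircle.toCircle_zero]
  exact Circle.coe_eq_one.1 h3.symm

/-- What matters later is that all Fourier coefficients are nonnegative and the constant one, at `l
= M`, decays only polynomially in `M`. -/
theorem coe_peak_pow (s : UnitAddCircle) (M : ℕ) :
    ((peak s ^ M : ℝ) : ℂ) = ∑ l ∈ Finset.range (2 * M + 1),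
      (((2 * M).choose l / 4 ^ M : ℝ) : ℂ) * ((((l : ℤ) - M) • s).toCircle : ℂ) := by
  rw [Complex.ofReal_pow, coe_peak, div_pow, mul_pow, ← pow_mul, add_comm (1 : ℂ), add_pow,
    Finset.mul_sum, Finset.sum_div]
  refine Finset.sum_congr rfl fun l _ => ?_
  rw [sub_smul, sub_eq_add_neg, AddCircle.toCircle_add, ← smul_neg, natCast_zsmul, natCast_zsmul,
    AddCircle.toCircle_nsmul, AddCircle.toCircle_nsmul]
  push_cast
  ring

/-- A product of peaks around a point of `𝕋^ℕ`, over finitely many coordinates. -/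
noncomputable def peakProd (I : Finset ℕ) (u t : ℕ → UnitAddCircle) : ℝ :=
  ∏ i : I, peak (t i - u i)

theorem continuous_peakProd (I : Finset ℕ) (u : ℕ → UnitAddCircle) :
    Continuous (peakProd I u) :=
  continuous_finsetProd _ fun i _ => continuous_peak.comp (by fun_prop)

theorem peakProd_nonneg (I : Finset ℕ) (u t : ℕ → UnitAddCircle) : 0 ≤ peakProd I u t :=
  Finset.prod_nonneg fun _ _ => peak_nonneg _

/-- The product attains its maximum on the compact complement of `U`; the value `1` would force
agreement with `u` on `I`, hence membership in `U`. -/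
theorem exists_peakProd_le {U : Set (ℕ → UnitAddCircle)} (hU : IsOpen U)
    {u : ℕ → UnitAddCircle} (hu : u ∈ U) :
    ∃ I : Finset ℕ, ∃ q : ℝ, 0 ≤ q ∧ q < 1 ∧ ∀ t ∉ U, peakProd I u t ≤ q := by
  obtain ⟨I, B, hB, hBU⟩ := isOpen_pi_iff.1 hU u hu
  refine ⟨I, ?_⟩
  rcases (Uᶜ).eq_empty_or_nonempty with hemp | hne
  · exact ⟨0, le_rfl, one_pos, fun t ht => absurd (hemp ▸ ht : t ∈ (∅ : Set _)) id⟩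
  · obtain ⟨t₀, ht₀, hmax⟩ := hU.isClosed_compl.isCompact.exists_isMaxOn hne
      (continuous_peakProd I u).continuousOn
    refine ⟨peakProd I u t₀, peakProd_nonneg _ _ _, ?_, fun t ht => hmax ht⟩
    obtain ⟨i, hi, hne⟩ : ∃ i ∈ I, t₀ i ≠ u i := by
      by_contra! h
      exact ht₀ (hBU fun i hi => (h i hi) ▸ (hB i hi).2)
    have hlt : peak (t₀ i - u i) < 1 := lt_of_le_of_ne (peak_le_one _) fun h =>
      hne (sub_eq_zero.1 (eq_zero_of_peak_eq_one h))
    rw [peakProd, ← Finset.mul_prod_erase Finset.univ _ (Finset.mem_univ (⟨i, hi⟩ : I))]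
    refine (mul_le_of_le_one_right (peak_nonneg _) ?_).trans_lt hlt
    exact Finset.prod_le_one (fun _ _ => peak_nonneg _) fun _ _ => peak_le_one _

theorem coe_peakProd_pow (I : Finset ℕ) (u t : ℕ → UnitAddCircle) (M : ℕ) :
    ((peakProd I u t ^ M : ℝ) : ℂ) =
      ∑ p ∈ Fintype.piFinset fun _ : I => Finset.range (2 * M + 1),
        ((∏ i, ((2 * M).choose (p i) / 4 ^ M : ℝ) : ℝ) : ℂ) *
          ((∑ i : I, ((p i : ℤ) - M) • (t i - u i)).toCircle : ℂ) := by
  have hsum : ∀ (s : Finset I) (f : I → UnitAddCircle),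
      ((∑ i ∈ s, f i).toCircle : ℂ) = ∏ i ∈ s, ((f i).toCircle : ℂ) := by
    intro s f
    induction s using Finset.cons_induction with
    | empty => simp
    | cons a s ha ih => rw [Finset.sum_cons, Finset.prod_cons, AddCircle.toCircle_add,
        Circle.coe_mul, ih]
  rw [peakProd, ← Finset.prod_pow, Complex.ofReal_prod]
  simp only [coe_peak_pow]
  rw [Finset.prod_univ_sum]
  refine Finset.sum_congr rfl fun p _ => ?_
  rw [Finset.prod_mul_distrib, hsum, Complex.ofReal_prod]

theorem inv_two_mul_add_one_le_centralBinom_div (M : ℕ) :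
    ((2 * M + 1 : ℝ))⁻¹ ≤ (2 * M).choose M / 4 ^ M := by
  have h : (4 : ℝ) ^ M ≤ (2 * M + 1) * (2 * M).choose M := by
    exact_mod_cast Nat.four_pow_le_two_mul_add_one_mul_central_binom M
  rw [le_div_iff₀ (by positivity), inv_mul_le_iff₀ (by positivity)]
  exact h

end Kernel

/-! ### Almost sure density in the `n`-torsion of `𝕋^ℕ` -/

section Density

variable {H : Type u} [AddCommGroup H] [MeasurableSpace (homSpace H)] [BorelSpace (homSpace H)]
  (μ : Measure (homSpace H)) [IsProbabilityMeasure μ] [μ.IsAddLeftInvariant]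

open Cardinal in
-- On this set `V` the `M`-th power of the peak product is at most `q ^ M`. As `j → ∞` its integral
-- tends to a sum of nonnegative terms including the constant Fourier coefficient times `μ V`, of
-- size at least `(2M+1)^{-|I|} μ V`. For large `M` this is impossible unless `μ V = 0`.
theorem homSpace.measure_forall_eval_notMem (hH : #H ≤ continuum.{u}) {n : ℕ} {e : ℕ → H}
    (he : ∀ j, n • e j = 0) (hseq : IsAlmostTorsionSeq n e) {u : ℕ → UnitAddCircle}
    (hu : n • u = 0) {U : Set (ℕ → UnitAddCircle)} (hU : IsOpen U) (huU : u ∈ U) :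
    μ {φ | ∀ j, homSpace.eval (e j) φ ∉ U} = 0 := by
  classical
  set V : Set (homSpace H) := {φ | ∀ j, homSpace.eval (e j) φ ∉ U} with hVdef
  have hV : MeasurableSet V := by
    simp only [hVdef, Set.ofPred_forall]
    exact MeasurableSet.iInter fun j =>
      (hU.isClosed_compl.preimage (continuous_eval (e j))).measurableSet
  obtain ⟨I, q, hq0, hq1, hq⟩ := exists_peakProd_le hU huU
  by_contra hne
  have hpos : 0 < μ.real V := ENNReal.toReal_pos hne (measure_ne_top μ V)
  have key : ∀ M : ℕ, ((2 * M + 1 : ℝ))⁻¹ ^ I.card ≤ q ^ M := by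
    intro M
    have hint : ∀ (j : ℕ) (p : I → ℕ), IntegrableOn (fun φ : homSpace H =>
        ((∏ i, ((2 * M).choose (p i) / 4 ^ M : ℝ) : ℝ) : ℂ) *
          ((∑ i : I, ((p i : ℤ) - M) • (homSpace.eval (e j) φ i - u i)).toCircle : ℂ)) V μ := by
      intro j p
      have hev := continuous_eval (e j)
      refine (Integrable.const_mul ?_ _).integrableOn
      refine Integrable.of_bound (Continuous.aestronglyMeasurable ?_) 1
        (Eventually.of_forall fun φ => (Circle.norm_coe _).le)
      have : Continuous fun φ : homSpace H =>
          ∑ i : I, ((p i : ℤ) - M) • (homSpace.eval (e j) φ i - u i) :=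
        continuous_finsetSum _ fun i _ =>
          (((continuous_apply (i : ℕ)).comp hev).sub continuous_const).zsmul _
      fun_prop
    have hlim : Tendsto
        (fun j => ((∫ φ in V, peakProd I u (homSpace.eval (e j) φ) ^ M ∂μ : ℝ) : ℂ)) atTop
        (𝓝 ((∑ p ∈ Fintype.piFinset fun _ : I => Finset.range (2 * M + 1),
          (∏ i, ((2 * M).choose (p i) / 4 ^ M : ℝ)) *
            (if ∀ i, (n : ℤ) ∣ ((p i : ℤ) - M) then μ.real V else 0) : ℝ) : ℂ)) := by
      have := tendsto_finsetSum (Fintype.piFinset fun _ : I => Finset.range (2 * M + 1))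
        fun p _ => (tendsto_setIntegral_character μ hH he hseq hu I
          (fun i => (p i : ℤ) - M) hV).const_mul
            ((∏ i, ((2 * M).choose (p i) / 4 ^ M : ℝ) : ℝ) : ℂ)
      simp only [← Complex.ofReal_zero, ← apply_ite Complex.ofReal, ← Complex.ofReal_mul,
        ← Complex.ofReal_sum] at this
      refine this.congr fun j => ?_
      rw [← integral_complex_ofReal]
      simp only [coe_peakProd_pow]
      rw [integral_finsetSum _ fun p _ => hint j p]
      simp only [integral_const_mul]
    have hre := (Complex.continuous_re.tendsto _).comp hlim
    have hle : ∀ j, ∫ φ in V, peakProd I u (homSpace.eval (e j) φ) ^ M ∂μ ≤ q ^ M * μ.real V := by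
      intro j
      refine (setIntegral_mono_on (g := fun _ => q ^ M) ?_ ?_ hV ?_).trans ?_
      · have hc : Continuous fun φ : homSpace H => peakProd I u (homSpace.eval (e j) φ) ^ M :=
          ((continuous_peakProd I u).comp (continuous_eval (e j))).pow M
        refine (Integrable.of_bound hc.aestronglyMeasurable 1
          (Eventually.of_forall fun φ => ?_)).integrableOn
        rw [Real.norm_of_nonneg (pow_nonneg (peakProd_nonneg _ _ _) _)]
        exact pow_le_one₀ (peakProd_nonneg _ _ _)
          (Finset.prod_le_one (fun _ _ => peak_nonneg _) fun _ _ => peak_le_one _)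
      · exact integrableOn_const
      · intro φ hφ
        exact pow_le_pow_left₀ (peakProd_nonneg _ _ _) (hq _ (hφ j)) M
      · simp [mul_comm]
    have h1 := le_of_tendsto' hre (b := q ^ M * μ.real V) fun j => by simpa using hle j
    rw [Complex.ofReal_re] at h1
    have h2 : (∏ _i : I, ((2 * M).choose M / 4 ^ M : ℝ)) * μ.real V ≤ q ^ M * μ.real V := by
      refine le_trans ?_ h1
      refine le_trans (le_of_eq ?_) (Finset.single_le_sum (fun p _ => ?_)
        (a := fun _ => M) (Fintype.mem_piFinset.2 fun _ => Finset.mem_range.2 (by omega)))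
      · simp
      · exact mul_nonneg (Finset.prod_nonneg fun _ _ => by positivity)
          (by split_ifs <;> positivity)
    refine le_trans ?_ (le_of_mul_le_mul_right h2 hpos)
    rw [Finset.prod_const, Finset.card_univ, Fintype.card_coe]
    exact pow_le_pow_left₀ (by positivity) (inv_two_mul_add_one_le_centralBinom_div M) _
  -- The factor `3` comes from `2 * M + 1 ≤ 3 * M` for `M ≥ 1`.
  have hlim := (tendsto_pow_const_mul_const_pow_of_lt_one I.card hq0 hq1).const_mul
    ((3 : ℝ) ^ I.card)
  rw [mul_zero] at hlim
  obtain ⟨M, hM, hM1⟩ := ((hlim.eventually (gt_mem_nhds one_pos)).and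
    (eventually_ge_atTop 1)).exists
  refine absurd hM (not_lt.2 ?_)
  have hM1' : (1 : ℝ) ≤ M := by exact_mod_cast hM1
  have h3 : (1 : ℝ) ≤ (2 * M + 1) ^ I.card * q ^ M := by
    have := key M
    rwa [inv_pow, inv_le_iff_one_le_mul₀' (by positivity)] at this
  refine h3.trans ?_
  rw [← mul_assoc, ← mul_pow]
  gcongr
  linarith

end Density

end MarkovZariski

/-! ### The embedding of `G` and the equivalence -/

namespace MarkovZariski

universe u

open MeasureTheory Filter Topology

open Cardinal in
-- Countability of `H`, of `ι` and of a basis of `𝕋^ℕ` leaves countably many conditions on `φ`, each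
-- holding almost surely for Haar measure.
theorem exists_injective_hom_forall_mem_closure {H : Type u} [AddCommGroup H] [Countable H]
    {ι : Type*} [Countable ι] {n : ℕ} (e : ι → ℕ → H) (he : ∀ i j, n • e i j = 0)
    (hseq : ∀ i, IsAlmostTorsionSeq n (e i)) :
    ∃ φ : H →+ (ℕ → UnitAddCircle), Function.Injective φ ∧
      ∀ i, ∀ u : ℕ → UnitAddCircle, n • u = 0 → u ∈ closure (Set.range fun j => φ (e i j)) := by
  have hH : #H ≤ continuum.{u} := (mk_le_aleph0 (α := H)).trans aleph0_le_continuum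
  let _ : MeasurableSpace (homSpace H) := borel _
  have : BorelSpace (homSpace H) := ⟨rfl⟩
  let μ : Measure (homSpace H) := Measure.addHaarMeasure ⊤
  have : IsProbabilityMeasure μ := ⟨Measure.addHaarMeasure_self (K₀ := ⊤)⟩
  let 𝓑 := TopologicalSpace.countableBasis (ℕ → UnitAddCircle)
  have h1 : ∀ᵐ φ ∂μ, ∀ h : H, h ≠ 0 → homSpace.eval h φ ≠ 0 := by
    refine ae_all_iff.2 fun h => ?_
    by_cases hh : h = 0
    · simp [hh]
    · filter_upwards [measure_eq_zero_iff_ae_notMem.1 (homSpace.measure_eval_eq_zero μ hH hh)]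
        with φ hφ _ using hφ
  have h2 : ∀ᵐ φ ∂μ, ∀ i, ∀ U ∈ 𝓑, (∃ u ∈ U, n • u = 0) → ∃ j, homSpace.eval (e i j) φ ∈ U := by
    refine ae_all_iff.2 fun i =>
      (ae_ball_iff (TopologicalSpace.countable_countableBasis _)).2 fun U hU => ?_
    by_cases hu : ∃ u ∈ U, n • u = 0
    · obtain ⟨u, huU, hu⟩ := hu
      filter_upwards [measure_eq_zero_iff_ae_notMem.1
        (homSpace.measure_forall_eval_notMem μ hH (he i) (hseq i) hu
          (TopologicalSpace.isOpen_of_mem_countableBasis hU) huU)] with φ hφ _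
      by_contra! h
      exact hφ h
    · simp [hu]
  obtain ⟨φ, hφ1, hφ2⟩ := (h1.and h2).exists
  refine ⟨homSpace.toHom φ, (injective_iff_map_eq_zero _).2 fun h hh => ?_, fun i u hu => ?_⟩
  · by_contra hne
    exact hφ1 h hne hh
  · rw [(TopologicalSpace.isBasis_countableBasis _).mem_closure_iff]
    intro U hU huU
    obtain ⟨j, hj⟩ := hφ2 i U hU ⟨u, huU, hu⟩
    exact ⟨_, hj, j, rfl⟩

theorem countable_span_int {G : Type u} [AddCommGroup G] {s : Set G} (hs : s.Countable) :
    Countable (Submodule.span ℤ s) := by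
  have := hs.to_subtype
  have h : (Set.range (Finsupp.linearCombination ℤ ((↑) : s → G))).Countable :=
    Set.countable_range _
  refine (h.mono fun x hx => ?_).to_subtype
  exact (Finsupp.mem_span_iff_linearCombination ℤ s x).1 hx

theorem exists_injective_hom_map_mem_closure {G : Type u} [AddCommGroup G]
    (hG : Cardinal.mk G ≤ Cardinal.continuum.{u}) {X : Set G}
    (hX : @closure G (zariskiTopology G) X = Set.univ) :
    ∃ φ : G →+ (ℕ → UnitAddCircle), Function.Injective φ ∧ ∀ g, φ g ∈ closure (φ '' X) := by
  obtain ⟨n, hn⟩ := exists_nat_finite_range_zsmul_iff_dvd G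
  have hrange : (Set.range fun x : G => n • x).Finite := by
    simpa using (hn n).2 dvd_rfl
  have := hrange.to_subtype
  choose r hr using fun v : Set.range (fun x : G => n • x) => v.2
  choose x hxX hxr hx using fun v => exists_isAlmostTorsionSeq hX hn (r v)
  let H : Submodule ℤ G := Submodule.span ℤ (Set.range r ∪ ⋃ v, Set.range (x v))
  have hHc : Countable H := countable_span_int
    ((Set.countable_range r).union (Set.countable_iUnion fun v => Set.countable_range (x v)))
  have hrH : ∀ v, r v ∈ H := fun v => Submodule.subset_span (Or.inl ⟨v, rfl⟩)
  have hxH : ∀ v j, x v j ∈ H := fun v j =>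
    Submodule.subset_span (Or.inr (Set.mem_iUnion.2 ⟨v, j, rfl⟩))
  let e : Set.range (fun x : G => n • x) → ℕ → H := fun v j => ⟨x v j, hxH v j⟩ - ⟨r v, hrH v⟩
  obtain ⟨φ₀, hinj, hcl⟩ := exists_injective_hom_forall_mem_closure e
    (fun v j => Subtype.ext (hxr v j)) (fun v k hk => by
      obtain ⟨J, hJ⟩ := hx v k hk
      refine ⟨J, fun i hi j hj hij => hJ i hi j hj ?_⟩
      have := congrArg Subtype.val hij
      simpa [e, smul_sub] using this)
  obtain ⟨φ, hφ, hφ₀⟩ := exists_injective_extension hG ⟨H, φ₀.toIntLinearMap⟩ hinj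
    ((Cardinal.mk_le_aleph0 (α := H)).trans_lt Cardinal.aleph0_lt_continuum)
  refine ⟨φ, hφ, fun g => ?_⟩
  let v : Set.range (fun x : G => n • x) := ⟨n • g, g, rfl⟩
  have hv : n • r v = n • g := hr v
  have hu := hcl v (φ g - φ (r v)) (by rw [smul_sub, ← map_nsmul, ← map_nsmul, hv, sub_self])
  have hmem := map_mem_closure (f := fun t => t + φ (r v)) (t := φ '' X) (by fun_prop) hu (by
    rintro _ ⟨j, rfl⟩
    refine ⟨x v j, hxX v j, ?_⟩
    have h1 : φ (x v j - r v) = φ₀ (e v j) := hφ₀ (e v j)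
    rw [map_sub] at h1
    simp only [← h1, sub_add_cancel])
  simpa using hmem

/-- The lift is needed because `IsPrecompactGroup` asks for a compact group in the universe of `G`.
-/
instance : IsTopologicalAddGroup (ULift.{u} (ℕ → UnitAddCircle)) where
  continuous_add := continuous_uliftUp.comp
    ((continuous_uliftDown.comp continuous_fst).add (continuous_uliftDown.comp continuous_snd))
  continuous_neg := continuous_uliftUp.comp continuous_uliftDown.neg

theorem isPrecompactMetricGroupTopology_induced {G : Type u} [AddCommGroup G]
    {φ : G →+ (ℕ → UnitAddCircle)} (hφ : Function.Injective φ) :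
    IsPrecompactMetricGroupTopology (TopologicalSpace.induced φ inferInstance) := by
  let _ : TopologicalSpace G := TopologicalSpace.induced φ inferInstance
  have hemb : IsEmbedding φ := ⟨⟨rfl⟩, hφ⟩
  refine ⟨topologicalAddGroup_induced φ, hemb.metrizableSpace,
    ULift.{u} (ℕ → UnitAddCircle), inferInstance, inferInstance, inferInstance, inferInstance,
    inferInstance, (AddEquiv.ulift.symm : _ ≃+ ULift.{u} (ℕ → UnitAddCircle)).toAddMonoidHom.comp φ,
    Homeomorph.ulift.symm.isEmbedding.comp hemb⟩

theorem exists_isPrecompactMetricGroupTopology_dense {G : Type u} [AddCommGroup G]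
    (hG : Cardinal.mk G ≤ Cardinal.continuum.{u}) {X : Set G}
    (hX : @closure G (zariskiTopology G) X = Set.univ) :
    ∃ t : TopologicalSpace G, IsPrecompactMetricGroupTopology t ∧ @Dense G t X := by
  obtain ⟨φ, hφ, hcl⟩ := exists_injective_hom_map_mem_closure hG hX
  exact ⟨_, isPrecompactMetricGroupTopology_induced hφ, fun g => closure_induced.2 (hcl g)⟩

theorem IsPrecompactMetricGroupTopology.isPotentiallyDense {G : Type u} [AddGroup G]
    {t : TopologicalSpace G} (ht : IsPrecompactMetricGroupTopology t) {X : Set G}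
    (hX : @Dense G t X) : IsPotentiallyDense X := by
  obtain ⟨h1, h2, -⟩ := ht
  exact ⟨t, h1, inferInstance, hX⟩

end MarkovZariski

theorem theoremD {G : Type*} [AddCommGroup G] (hG : Cardinal.mk G ≤ Cardinal.continuum)
    (X : Set G) :
    List.TFAE [
      MarkovZariski.IsPotentiallyDense X,
      ∃ t : TopologicalSpace G, MarkovZariski.IsPrecompactMetricGroupTopology t ∧ @Dense G t X,
      @closure G (MarkovZariski.zariskiTopology G) X = Set.univ] := by
  tfae_have 1 → 3 := fun h => h.closure_zariskiTopology
  tfae_have 3 → 2 := MarkovZariski.exists_isPrecompactMetricGroupTopology_dense hG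
  tfae_have 2 → 1 := fun ⟨_, ht, hd⟩ => ht.isPotentiallyDense hd
  tfae_finish
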